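/- Let $E$ be a real Banach space with dual $E^*$ and normalized duality mapping $J(x)=\{j\in E^*:\langle x,j\rangle=\|x\|\|j\|,\ \|j\|=\|x\|\}$. Suppose that $E$ is 2-uniformly smooth: there is $c>0$ such that $\rho_E(t)\le ct^2$ for all $t\ge 0$, where $\rho_E(t)=\sup\{\tfrac12(\|x+y\|+\|x-y\|)-1:\ \|x\|=1,\ \|y\|\le t\}$. Let $K$ be the best smoothness constant of $E$, i.e. the smallest $K\ge 0$ such that $\|x+y\|^2\le\|x\|^2+2\langle y,j\rangle+2\|Ky\|^2$ for all $x,y\in E$ and $j\in J(x)$ (so $K>0$ unless $E=\{0\}$, where there is nothing to prove). Let $C\subseteq E$ be closed and convex, let $\lambda\in(0,1)$, and let $T:C\to C$ be a $\lambda$-strict pseudocontraction, i.e. for all $x,y\in C$ there is $j\in J(x-y)$ with $$\langle Tx-Ty,j\rangle\le\|x-y\|^2-\lambda\|x-y-(Tx-Ty)\|^2 .$$ Suppose that $T$ has a fixed point. Let $(\alpha_n),(\beta_n),(\gamma_n)$ be sequences in $[0,1]$ such that (i) $\alpha_n\in[0,\min\{1,\lambda/K^2\}]$ for all $n$ and $\liminf_{n\to\infty}\alpha_n(\lambda-K^2\alpha_n)>0$;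 (ii) $\lim_{n\to\infty}\beta_n=0$ and $\sum_n\beta_n=\infty$; (iii) $\limsup_{n\to\infty}\gamma_n<1$. Let $u\in C$ and let $(x_n)_{n\ge0}$ be a sequence in $C$ such that, for all $n\ge 0$, $$x_{n+1}=\beta_nu+\gamma_nx_n+(1-\beta_n-\gamma_n)\bigl[\alpha_nTx_n+(1-\alpha_n)x_n\bigr]$$ (if $\beta_n+\gamma_n\le1$ for all $n$, every $x_0\in C$ generates such a sequence). Then $(x_n)$ converges strongly to a fixed point $z$ of $T$. Moreover, for every $t\in(0,1)$ there is exactly one $x_t\in C$ with $x_t=tu+(1-t)Tx_t$, and $z=\lim_{t\to0^+}x_t$. -/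

import Mathlib

open Filter Topology Set

/-- The normalized duality mapping `J : E → 2^{E*}`. -/
def normalizedDuality {E : Type*} [NormedAddCommGroup E] [NormedSpace ℝ E] (x : E) :
    Set (StrongDual ℝ E) :=
  {j | j x = ‖x‖ * ‖j‖ ∧ ‖x‖ = ‖j‖}

/-- The modulus of smoothness
`ρ_E(t) = sup {(‖x + y‖ + ‖x - y‖) / 2 - 1 : ‖x‖ = 1, ‖y‖ ≤ t}`.
The set is bounded above by `t`. -/
noncomputable def modulusOfSmoothness (E : Type*) [NormedAddCommGroup E] [NormedSpace ℝ E]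
    (t : ℝ) : ℝ :=
  sSup {r : ℝ | ∃ x y : E, ‖x‖ = 1 ∧ ‖y‖ ≤ t ∧ r = 1 / 2 * (‖x + y‖ + ‖x - y‖) - 1}

/-- `E` is 2-uniformly smooth: `ρ_E(t) ≤ c t²` for some constant `c > 0`. -/
def IsTwoUniformlySmooth (E : Type*) [NormedAddCommGroup E] [NormedSpace ℝ E] : Prop :=
  ∃ c : ℝ, 0 < c ∧ ∀ t : ℝ, 0 ≤ t → modulusOfSmoothness E t ≤ c * t ^ 2

/-- The best smoothness constant of `E`: the smallest `K ≥ 0` with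
`‖x + y‖² ≤ ‖x‖² + 2⟨y, j⟩ + 2‖K y‖²` for all `x, y ∈ E` and `j ∈ J(x)`.
(In a 2-uniformly smooth space such `K` exist and the infimum is attained; in a nonzero Hilbert
space it is `1 / √2`.) -/
noncomputable def bestSmoothnessConstant (E : Type*) [NormedAddCommGroup E]
    [NormedSpace ℝ E] : ℝ :=
  sInf {K : ℝ | 0 ≤ K ∧ ∀ x y : E, ∀ j ∈ normalizedDuality x,
    ‖x + y‖ ^ 2 ≤ ‖x‖ ^ 2 + 2 * j y + 2 * ‖K • y‖ ^ 2}

/-- `T : C → C` is a `lam`-strict pseudocontraction. -/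
def IsStrictPseudocontraction {E : Type*} [NormedAddCommGroup E] [NormedSpace ℝ E]
    {C : Set E} (lam : ℝ) (T : C → C) : Prop :=
  lam ∈ Ioo (0 : ℝ) 1 ∧ ∀ x y : C, ∃ j ∈ normalizedDuality ((x : E) - y),
    j ((T x : E) - T y) ≤
      ‖(x : E) - y‖ ^ 2 - lam * ‖(x : E) - y - ((T x : E) - T y)‖ ^ 2

/-! ### Elementary properties of the duality mapping. -/

section Duality

variable {E : Type*} [NormedAddCommGroup E] [NormedSpace ℝ E] {x : E} {j : StrongDual ℝ E}

/-! Smoothness bounds `‖x + y‖ ^ 2` above by `‖x‖ ^ 2 + 2 * j y` plus `2 * K ^ 2 * ‖y‖ ^ 2`; the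
subgradient inequality bounds it below by the same linear part. These two bounds replace any
continuity of the duality mapping.

Averaging. The upper bound makes `S = a T + (1 - a) I` averaged, with the fixed points of `T`,
whenever `0 < a` and `K ^ 2 * a < lam` (`IsStrictPseudocontraction.isAveraged`).

The limit point. Let `y t = t u + (1 - t) S (y t)`. The space is reflexive, so along any ultrafilter
tending to `0+` the curve has an asymptotic center in `C`. Averagedness forces the center to be a
fixed point, and smoothness forces its radius to vanish, so the curve converges strongly along the
ultrafilter. A variational inequality makes all these limits equal to one point `z`
(`exists_tendsto_anchored`). The curve of `T` is a reparametrization of that of `S`.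

The iteration. With `d n = ‖x n - z‖ ^ 2` one has `d (n + 1) ≤ (1 - β n) d n - c ‖x n - T (x n)‖ ^ 2
+ 2 β n j (u - z)`, where `j` is dual to `x (n + 1) - z`. If the displacement is small, the
variational inequality is approximately valid at `x (n + 1)` (`exists_forall_apply_sub_le`); if it
is large, the negative term absorbs the last one. Then `∑ β n = ∞` gives `d n → 0`. -/

theorem normalizedDuality_nonempty (x : E) : (normalizedDuality x).Nonempty := by
  rcases eq_or_ne x 0 with rfl | hx
  · exact ⟨0, by simp [normalizedDuality]⟩
  · obtain ⟨g, hg, hgx⟩ := exists_dual_vector ℝ x (by simpa using hx)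
    refine ⟨‖x‖ • g, ?_, ?_⟩
    · simp [hgx, norm_smul, hg]
    · simp [norm_smul, hg]

theorem normalizedDuality.apply_self (hj : j ∈ normalizedDuality x) : j x = ‖x‖ ^ 2 := by
  rw [hj.1, ← hj.2, sq]

theorem normalizedDuality.apply_le (hj : j ∈ normalizedDuality x) (y : E) :
    j y ≤ ‖x‖ * ‖y‖ := by
  rw [hj.2]
  exact (le_abs_self _).trans (j.le_opNorm y)

theorem normalizedDuality.neg_mem (hj : j ∈ normalizedDuality x) :
    -j ∈ normalizedDuality (-x) := by
  refine ⟨?_, ?_⟩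
  · simpa using hj.1
  · simpa using hj.2

/-- The functionals of `J x` are subgradients of `‖·‖² / 2` at `x`. -/
theorem normalizedDuality.le_norm_add_sq (hj : j ∈ normalizedDuality x) (y : E) :
    ‖x‖ ^ 2 + 2 * j y ≤ ‖x + y‖ ^ 2 := by
  have h1 := normalizedDuality.apply_le hj (x + y)
  rw [map_add, normalizedDuality.apply_self hj] at h1
  nlinarith [sq_nonneg (‖x‖ - ‖x + y‖)]

end Duality

/-! ### From the modulus of smoothness to the quadratic inequality. -/

section Smoothness

variable {E : Type*} [NormedAddCommGroup E] [NormedSpace ℝ E]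

theorem IsTwoUniformlySmooth.exists_norm_add_add_norm_sub_le (hE : IsTwoUniformlySmooth E) :
    ∃ c : ℝ, 0 < c ∧ ∀ x y : E, ‖x‖ = 1 → ‖x + y‖ + ‖x - y‖ ≤ 2 + 2 * c * ‖y‖ ^ 2 := by
  obtain ⟨c, hc, h⟩ := hE
  refine ⟨c, hc, fun x y hx => ?_⟩
  have h1 : 1 / 2 * (‖x + y‖ + ‖x - y‖) - 1 ≤ modulusOfSmoothness E ‖y‖ := by
    refine le_csSup ⟨‖y‖, ?_⟩ ⟨x, y, hx, le_rfl, rfl⟩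
    rintro _ ⟨a, b, ha, hb, rfl⟩
    have := norm_add_le a b
    have := norm_sub_le a b
    linarith
  linarith [h _ (norm_nonneg y)]

/-- `‖x + y‖² ≤ ‖x‖² + 2⟨y, j⟩ + 2K²‖y‖²` for all `j ∈ J x`. -/
def HasSmoothnessConstant (E : Type*) [NormedAddCommGroup E] [NormedSpace ℝ E] (K : ℝ) : Prop :=
  ∀ x y : E, ∀ j ∈ normalizedDuality x,
    ‖x + y‖ ^ 2 ≤ ‖x‖ ^ 2 + 2 * j y + 2 * K ^ 2 * ‖y‖ ^ 2

/-- Since `1 - j y ≤ ‖x - y‖`, smoothness gives `‖x + y‖ ≤ 1 + j y + 2 c ‖y‖ ^ 2`, which is squared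
when `‖y‖ ≤ 1`. For `‖y‖ ≥ 1` the triangle inequality is enough and accounts for the constant 5. -/
theorem norm_add_sq_le_of_norm_eq_one {c : ℝ} (hc : 0 < c)
    (h : ∀ x y : E, ‖x‖ = 1 → ‖x + y‖ + ‖x - y‖ ≤ 2 + 2 * c * ‖y‖ ^ 2)
    {x : E} (hx : ‖x‖ = 1) (y : E) {j : StrongDual ℝ E} (hj : j ∈ normalizedDuality x) :
    ‖x + y‖ ^ 2 ≤ 1 + 2 * j y + (5 + 8 * c + 4 * c ^ 2) * ‖y‖ ^ 2 := by
  have h1 := normalizedDuality.apply_le hj y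
  have h2 := normalizedDuality.apply_le hj (-y)
  have h3 := normalizedDuality.apply_le hj (x - y)
  have h4 := h x y hx
  rw [map_sub, normalizedDuality.apply_self hj, hx] at h3
  rw [hx] at h1 h2
  rw [map_neg, norm_neg] at h2
  have hs := norm_nonneg y
  have hn := norm_nonneg (x + y)
  have h5 := norm_add_le x y
  rw [hx] at h5
  set s := ‖y‖
  set a := j y
  set b := ‖x + y‖
  have hb : b ≤ 1 + a + 2 * c * s ^ 2 := by linarith
  rcases le_total s 1 with hs1 | hs1
  · have hb2 : b ^ 2 ≤ (1 + a + 2 * c * s ^ 2) ^ 2 := pow_le_pow_left₀ hn hb 2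
    have ha : a ^ 2 ≤ s ^ 2 := by nlinarith
    have ha2 : c * s ^ 2 * a ≤ c * s ^ 2 := by
      have : 0 ≤ c * s ^ 2 := by positivity
      nlinarith
    have hs4 : c ^ 2 * s ^ 4 ≤ c ^ 2 * s ^ 2 := by
      have : s ^ 4 ≤ s ^ 2 := pow_le_pow_of_le_one hs hs1 (by norm_num)
      have := sq_nonneg c
      nlinarith
    nlinarith [sq_nonneg s]
  · have hb2 : b ^ 2 ≤ (1 + s) ^ 2 := pow_le_pow_left₀ hn h5 2
    have : 0 ≤ (8 * c + 4 * c ^ 2) * s ^ 2 := by positivity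
    nlinarith

theorem IsTwoUniformlySmooth.exists_hasSmoothnessConstant (hE : IsTwoUniformlySmooth E) :
    ∃ K : ℝ, 0 ≤ K ∧ HasSmoothnessConstant E K := by
  obtain ⟨c, hc, h⟩ := hE.exists_norm_add_add_norm_sub_le
  set D := 5 + 8 * c + 4 * c ^ 2 with hD
  have hDpos : 1 ≤ D := by nlinarith [sq_nonneg c]
  refine ⟨√D, Real.sqrt_nonneg _, fun x y j hj => ?_⟩
  rw [Real.sq_sqrt (by linarith)]
  have hy2 := sq_nonneg ‖y‖
  rcases eq_or_ne x 0 with rfl | hx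
  · have hj0 : j = 0 := by simpa using hj.2.symm
    simp only [hj0, zero_add, norm_zero]
    simp
    nlinarith
  · have hx0 : 0 < ‖x‖ := norm_pos_iff.2 hx
    have key := norm_add_sq_le_of_norm_eq_one hc h (x := ‖x‖⁻¹ • x)
      (by rw [norm_smul, norm_inv, norm_norm, inv_mul_cancel₀ hx0.ne']) (‖x‖⁻¹ • y)
      (j := ‖x‖⁻¹ • j) ⟨by
        simp [norm_smul, hj.1]; ring, by simp [norm_smul, hj.2]⟩
    rw [← smul_add, norm_smul, norm_smul, norm_inv, norm_norm] at key
    simp only [smul_apply, map_smul, smul_eq_mul] at key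
    have key2 := mul_le_mul_of_nonneg_left key (sq_nonneg ‖x‖)
    have e1 : ‖x‖ ^ 2 * (‖x‖⁻¹ * ‖x + y‖) ^ 2 = ‖x + y‖ ^ 2 := by field_simp
    have e2 : ‖x‖ ^ 2 * (1 + 2 * (‖x‖⁻¹ * (‖x‖⁻¹ * j y)) +
        (5 + 8 * c + 4 * c ^ 2) * (‖x‖⁻¹ * ‖y‖) ^ 2) = ‖x‖ ^ 2 + 2 * j y + D * ‖y‖ ^ 2 := by
      rw [← hD]; field_simp
    rw [e1, e2] at key2
    nlinarith

/-- The infimum is attained: it lies in the closure of the admissible set, and for each fixed `x`,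
`y`, `j` the inequality is a closed condition on `K`. -/
theorem IsTwoUniformlySmooth.hasSmoothnessConstant (hE : IsTwoUniformlySmooth E) :
    HasSmoothnessConstant E (bestSmoothnessConstant E) := by
  intro x y j hj
  obtain ⟨K₀, hK₀, hK₀'⟩ := hE.exists_hasSmoothnessConstant
  set A := {K : ℝ | 0 ≤ K ∧ ∀ x y : E, ∀ j ∈ normalizedDuality x,
    ‖x + y‖ ^ 2 ≤ ‖x‖ ^ 2 + 2 * j y + 2 * ‖K • y‖ ^ 2} with hA
  have hne : A.Nonempty := by
    refine ⟨K₀, hK₀, fun x y j hj => ?_⟩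
    have := hK₀' x y j hj
    rw [norm_smul, mul_pow, Real.norm_eq_abs, sq_abs]
    linarith
  have hmem : sInf A ∈ closure A := csInf_mem_closure hne ⟨0, fun K hK => hK.1⟩
  have hcl : IsClosed {K : ℝ | ‖x + y‖ ^ 2 ≤ ‖x‖ ^ 2 + 2 * j y + 2 * K ^ 2 * ‖y‖ ^ 2} :=
    isClosed_le (by fun_prop) (by fun_prop)
  refine closure_minimal (fun K hK => ?_) hcl hmem
  have := hK.2 x y j hj
  rw [norm_smul, mul_pow, Real.norm_eq_abs, sq_abs] at this
  rw [mem_ofPred_eq]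
  linarith

end Smoothness

/-! ### Reflexivity of 2-uniformly smooth spaces and minimization of convex functions. -/

section Reflexivity

theorem StrongDual.exists_lt_apply_of_lt_norm {X : Type*} [NormedAddCommGroup X] [NormedSpace ℝ X]
    (f : StrongDual ℝ X) {r : ℝ} (hr : r < ‖f‖) : ∃ x : X, ‖x‖ ≤ 1 ∧ r < f x := by
  obtain ⟨x, hx, hfx⟩ := f.exists_lt_apply_of_lt_opNorm hr
  rcases le_total 0 (f x) with h | h
  · exact ⟨x, hx.le, by rwa [Real.norm_of_nonneg h] at hfx⟩
  · exact ⟨-x, by simpa using hx.le, by rwa [Real.norm_of_nonpos h, ← map_neg] at hfx⟩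

/-- If `‖Φ - c • f‖ ≥ r` for all scalars `c`, then `Φ` is at least almost `r` on some unit vector
of the kernel of `f`. -/
theorem StrongDual.exists_lt_apply_of_forall_le_norm_sub {X : Type*} [NormedAddCommGroup X]
    [NormedSpace ℝ X] {Φ f : StrongDual ℝ X} {r s : ℝ} (h : ∀ c : ℝ, r ≤ ‖Φ - c • f‖)
    (hs : s < r) : ∃ x : X, ‖x‖ ≤ 1 ∧ f x = 0 ∧ s < Φ x := by
  let p : Submodule ℝ X := LinearMap.ker (f : X →ₗ[ℝ] ℝ)
  -- Hahn–Banach extends the restriction of `Φ` to `ker f` without increasing the norm. The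
  -- extension differs from `Φ` by a multiple of `f`, so the restriction has norm at least `r`.
  obtain ⟨g, hg, hgn⟩ := exists_extension_norm_eq p (Φ.comp p.subtypeL)
  obtain ⟨c, hc⟩ : ∃ c : ℝ, Φ - g = c • f := by
    have := mem_span_of_iInf_ker_le_ker (ι := Unit) (L := fun _ => (f : X →ₗ[ℝ] ℝ))
      (K := ((Φ - g : StrongDual ℝ X) : X →ₗ[ℝ] ℝ)) (by
        intro y hy
        rw [iInf_const] at hy
        have := hg ⟨y, hy⟩
        simp at this
        simp [this])
    rw [Set.range_const, Submodule.mem_span_singleton] at this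
    obtain ⟨c, hc⟩ := this
    exact ⟨c, by ext y; exact (LinearMap.congr_fun hc y).symm⟩
  have h1 : s < ‖Φ.comp p.subtypeL‖ := by
    rw [← hgn, show g = Φ - c • f by rw [← hc]; abel]
    exact hs.trans_le (h c)
  obtain ⟨y, hy, hΦ⟩ := StrongDual.exists_lt_apply_of_lt_norm _ h1
  exact ⟨y, hy, y.2, hΦ⟩

variable {E : Type*} [NormedAddCommGroup E] [NormedSpace ℝ E]

/-- Were the space not reflexive, a unit `Φ` almost at distance 1 from it would yield functionals
`j`, `i` in the dual ball, a unit vector `v` and a vector `x` of the unit ball with `j v + i v` near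
2, `j x` near 1 and `i x = 0`. Then `‖v + τ x‖ + ‖v - τ x‖ ≥ j (v + τ x) + i (v - τ x)` is about `2
+ τ`, too large for small `τ`. -/
theorem IsTwoUniformlySmooth.surjective_inclusionInDoubleDual [CompleteSpace E]
    (hE : IsTwoUniformlySmooth E) :
    Function.Surjective (NormedSpace.inclusionInDoubleDual ℝ E) := by
  obtain ⟨c, hc, hsm⟩ := hE.exists_norm_add_add_norm_sub_le
  let R : Submodule ℝ (StrongDual ℝ (StrongDual ℝ E)) :=
    LinearMap.range (NormedSpace.inclusionInDoubleDualLi (𝕜 := ℝ) (E := E)).toLinearMap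
  have hR : IsClosed (R : Set (StrongDual ℝ (StrongDual ℝ E))) :=
    IsComplete.isClosed
      (NormedSpace.inclusionInDoubleDualLi (𝕜 := ℝ) (E := E)
        ).isometry.isUniformInducing.isComplete_range
  by_contra hns
  obtain ⟨Φ₀, hΦ₀⟩ := not_forall.1 hns
  obtain ⟨ε, hε, hε4, hεc⟩ : ∃ ε : ℝ, 0 < ε ∧ 16 * ε < 1 ∧ 64 * c * ε < 1 := by
    refine ⟨1 / (64 * (1 + c)), by positivity, ?_, ?_⟩
    · rw [mul_one_div, div_lt_one (by positivity)]; linarith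
    · rw [mul_one_div, div_lt_one (by positivity)]; linarith
  obtain ⟨Φ, -, hΦ1, hΦ⟩ := riesz_lemma_of_lt_one (𝕜 := ℝ) hR ⟨Φ₀, hΦ₀⟩
    (show 1 - ε < 1 by linarith)
  obtain ⟨j, hj, hΦj⟩ := StrongDual.exists_lt_apply_of_lt_norm Φ (r := 1 - ε) (by linarith)
  have hjn : 1 - ε < ‖j‖ := by
    have := (le_abs_self _).trans (Φ.le_opNorm j)
    rw [hΦ1] at this
    linarith
  obtain ⟨x, hx, hjx⟩ := StrongDual.exists_lt_apply_of_lt_norm j hjn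
  obtain ⟨i, hi, hix, hΦi⟩ := StrongDual.exists_lt_apply_of_forall_le_norm_sub (Φ := Φ)
    (f := NormedSpace.inclusionInDoubleDual ℝ E x) (r := 1 - ε) (s := 1 - 2 * ε)
    (fun a => hΦ _ ⟨a • x, by simp; rfl⟩) (by linarith)
  rw [NormedSpace.dual_def] at hix
  have hsum : 2 - 3 * ε < ‖j + i‖ := by
    have := (le_abs_self _).trans (Φ.le_opNorm (j + i))
    rw [hΦ1, map_add] at this
    linarith
  obtain ⟨w, hw, hjiw⟩ := StrongDual.exists_lt_apply_of_lt_norm _ hsum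
  have hle : ∀ (f : StrongDual ℝ E) (y : E), ‖f‖ ≤ 1 → f y ≤ ‖y‖ := fun f y hf =>
    ((le_abs_self _).trans (f.le_opNorm y)).trans (mul_le_of_le_one_left (norm_nonneg y) hf)
  have hw0 : 0 < ‖w‖ := by
    rw [norm_pos_iff]
    rintro rfl
    simp at hjiw
    linarith
  -- normalise `w`
  obtain ⟨v, hv, hjiv⟩ : ∃ v : E, ‖v‖ = 1 ∧ 2 - 3 * ε < j v + i v := by
    refine ⟨‖w‖⁻¹ • w, by rw [norm_smul, norm_inv, norm_norm, inv_mul_cancel₀ hw0.ne'], ?_⟩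
    have h1 : 1 ≤ ‖w‖⁻¹ := (one_le_inv₀ hw0).2 hw
    rw [add_apply] at hjiw
    rw [map_smul, map_smul, smul_eq_mul, smul_eq_mul]
    nlinarith
  -- With `τ = 1 / (4 c)` smoothness allows an excess of at most `τ / 2` over 2, while the
  -- functionals give more than `τ (1 - ε) - 3 ε`. The choice of `ε` ensures `16 ε < τ`, so the two
  -- are incompatible.
  obtain ⟨τ, hτ, hcτ⟩ : ∃ τ : ℝ, 0 < τ ∧ c * τ = 1 / 4 :=
    ⟨1 / (4 * c), by positivity, by field_simp⟩
  have h1 := hsm v (τ • x) hv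
  have h2 := hle j (v + τ • x) hj
  have h3 := hle i (v - τ • x) hi
  have h4 : ‖τ • x‖ ≤ τ := by
    rw [norm_smul, Real.norm_of_nonneg hτ.le]
    exact mul_le_of_le_one_right hτ.le hx
  have h5 : c * ‖τ • x‖ ^ 2 ≤ τ / 4 := by
    have : ‖τ • x‖ ^ 2 ≤ τ ^ 2 := pow_le_pow_left₀ (norm_nonneg _) h4 2
    calc c * ‖τ • x‖ ^ 2 ≤ c * τ ^ 2 := by gcongr
      _ = τ / 4 := by rw [sq, ← mul_assoc, hcτ]; ring
  rw [map_add, map_smul, smul_eq_mul] at h2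
  rw [map_sub, map_smul, smul_eq_mul, hix, mul_zero, sub_zero] at h3
  have h6 : 16 * ε < τ := by
    have : c * (16 * ε) < c * τ := by rw [hcτ]; linarith
    exact lt_of_mul_lt_mul_left this hc.le
  nlinarith

/-- Closed bounded convex subsets of a reflexive space are weakly compact. -/
theorem Convex.isCompact_toWeakSpace_image
    (hrefl : Function.Surjective (NormedSpace.inclusionInDoubleDual ℝ E))
    {A : Set E} (hA : Convex ℝ A) (hcl : IsClosed A) (hb : Bornology.IsBounded A) :
    IsCompact (toWeakSpace ℝ E '' A) := by
  have h1 : closure (toWeakSpace ℝ E '' A) = toWeakSpace ℝ E '' A := by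
    rw [← hA.toWeakSpace_closure ℝ, hcl.closure_eq]
  rw [← h1]
  refine NormedSpace.isCompact_closure_of_isBounded ℝ E _ ?_ ?_
  · rwa [preimage_image_eq _ (toWeakSpace ℝ E).injective]
  · rintro φ -
    obtain ⟨y, hy⟩ := hrefl (WeakDual.toStrongDual φ)
    exact ⟨toWeakSpace ℝ E y, by
      rw [NormedSpace.inclusionInDoubleDualWeak_apply]
      simp [hy]⟩

/-- A convex continuous function with bounded sublevel sets attains its infimum on a nonempty
closed convex subset of a reflexive space. -/
theorem ConvexOn.exists_isMinOn_of_surjective_inclusionInDoubleDual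
    (hrefl : Function.Surjective (NormedSpace.inclusionInDoubleDual ℝ E))
    {C : Set E} (hcl : IsClosed C) (hne : C.Nonempty)
    {g : E → ℝ} (hg : ConvexOn ℝ C g) (hgc : Continuous g) (hbd : BddBelow (g '' C))
    (hcoer : ∀ r : ℝ, Bornology.IsBounded {z ∈ C | g z ≤ r}) :
    ∃ v ∈ C, IsMinOn g C v := by
  set m := sInf (g '' C)
  -- These sublevel sets decrease and are weakly compact, so they have a common point, which is a
  -- minimizer.
  let A : ℕ → Set E := fun n => {z ∈ C | g z ≤ m + 1 / ((n : ℝ) + 1)}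
  have hAcl : ∀ n, IsClosed (A n) := fun n =>
    hcl.inter (isClosed_le hgc continuous_const)
  have hAcv : ∀ n, Convex ℝ (A n) := fun n => hg.convex_le _
  have hAcp : ∀ n, IsCompact (toWeakSpace ℝ E '' A n) := fun n =>
    (hAcv n).isCompact_toWeakSpace_image hrefl (hAcl n) (hcoer _)
  have hAne : ∀ n, (A n).Nonempty := by
    intro n
    obtain ⟨_, ⟨z, hz, rfl⟩, hlt⟩ := exists_lt_of_csInf_lt (hne.image g)
      (show m < m + 1 / ((n : ℝ) + 1) by have : 0 < 1 / ((n : ℝ) + 1) := by positivity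
                                         linarith)
    exact ⟨z, hz, hlt.le⟩
  have hwcl : ∀ n, IsClosed (toWeakSpace ℝ E '' A n) := by
    intro n
    rw [← (hAcl n).closure_eq, (hAcv n).toWeakSpace_closure ℝ]
    exact isClosed_closure
  obtain ⟨y, hy⟩ := IsCompact.nonempty_iInter_of_sequence_nonempty_isCompact_isClosed
    (fun n => toWeakSpace ℝ E '' A n)
    (fun n => image_mono fun z hz => ⟨hz.1, hz.2.trans (by gcongr; linarith)⟩)
    (fun n => (hAne n).image _) (hAcp 0) hwcl
  rw [mem_iInter] at hy
  have hy' : ∀ n, (toWeakSpace ℝ E).symm y ∈ A n := by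
    intro n
    obtain ⟨z, hz, rfl⟩ := hy n
    simpa using hz
  refine ⟨_, (hy' 0).1, fun z hz => ?_⟩
  have h1 : g ((toWeakSpace ℝ E).symm y) ≤ m := by
    refine le_of_tendsto_of_tendsto' tendsto_const_nhds
      (b := atTop)
      (f := fun _ : ℕ => g ((toWeakSpace ℝ E).symm y)) (g := fun n : ℕ => m + 1 / ((n : ℝ) + 1)) ?_
      fun n => (hy' n).2
    simpa using tendsto_one_div_add_atTop_nhds_zero_nat.const_add m
  exact h1.trans (csInf_le hbd ⟨z, hz, rfl⟩)

end Reflexivity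

/-! ### Asymptotic centers along an ultrafilter. -/

section AsymptoticCenter

variable {E : Type*} [NormedAddCommGroup E] [NormedSpace ℝ E]

/-- In a reflexive space, a family which is bounded along an ultrafilter has an asymptotic center
in every nonempty closed convex set. -/
theorem exists_asymptoticCenter
    (hrefl : Function.Surjective (NormedSpace.inclusionInDoubleDual ℝ E))
    {C : Set E} (hC : Convex ℝ C) (hcl : IsClosed C) (hne : C.Nonempty)
    {ι : Type*} (U : Ultrafilter ι) (x : ι → E) {M : ℝ} (hx : ∀ᶠ i in (U : Filter ι), ‖x i‖ ≤ M) :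
    ∃ g : E → ℝ, (∀ z, Tendsto (fun i => ‖x i - z‖) U (𝓝 (g z))) ∧
      ∃ v ∈ C, ∀ z ∈ C, g v ≤ g z := by
  have hlim : ∀ z, ∃ r, Tendsto (fun i => ‖x i - z‖) U (𝓝 r) := by
    intro z
    obtain ⟨r, -, hr⟩ := (isCompact_Icc (a := (0 : ℝ)) (b := M + ‖z‖)).ultrafilter_le_nhds
      (U.map fun i => ‖x i - z‖) (by
        rw [le_principal_iff, Ultrafilter.mem_coe, Ultrafilter.mem_map]
        change ∀ᶠ i in (U : Filter ι), ‖x i - z‖ ∈ Icc 0 (M + ‖z‖)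
        filter_upwards [hx] with i hi
        exact ⟨norm_nonneg _, (norm_sub_le _ _).trans (by linarith)⟩)
    exact ⟨r, hr⟩
  choose g hg using hlim
  have hg0 : ∀ z, 0 ≤ g z := fun z => ge_of_tendsto' (hg z) fun i => norm_nonneg _
  -- As a pointwise limit of distances, `g` is convex and 1-Lipschitz; the bound on the family makes
  -- it coercive.
  refine ⟨g, hg, ConvexOn.exists_isMinOn_of_surjective_inclusionInDoubleDual hrefl hcl hne
    ⟨hC, ?_⟩ (LipschitzWith.of_le_add ?_).continuous ⟨0, ?_⟩ ?_⟩
  · intro z _ w _ a b ha hb hab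
    refine le_of_tendsto_of_tendsto' (hg _) (((hg z).const_mul a).add ((hg w).const_mul b))
      fun i => ?_
    calc ‖x i - (a • z + b • w)‖ = ‖a • (x i - z) + b • (x i - w)‖ := by
          congr 1
          nth_rw 1 [← one_smul ℝ (x i), ← hab]
          module
      _ ≤ a * ‖x i - z‖ + b * ‖x i - w‖ := by
          refine (norm_add_le _ _).trans ?_
          rw [norm_smul, norm_smul, Real.norm_of_nonneg ha, Real.norm_of_nonneg hb]
  · intro z w
    refine le_of_tendsto_of_tendsto' (hg z) ((hg w).add_const _) fun i => ?_
    have := norm_sub_le_norm_sub_add_norm_sub (x i) w z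
    rwa [dist_comm, dist_eq_norm]
  · rintro _ ⟨z, -, rfl⟩
    exact hg0 z
  · intro r
    refine (Metric.isBounded_closedBall (x := (0 : E)) (r := r + M)).subset fun z hz => ?_
    rw [mem_closedBall_zero_iff]
    have h1 : ‖z‖ ≤ g z + M := by
      refine ge_of_tendsto ((hg z).add_const M) ?_
      filter_upwards [hx] with i hi
      have := norm_sub_norm_le z (x i)
      rw [norm_sub_rev] at this
      linarith
    linarith [hz.2]

end AsymptoticCenter

/-- A quantitative form of averagedness: nonexpansiveness with a gain of `δ` times the squared
displacement of `I - S`. -/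
def IsAveraged {E : Type*} [NormedAddCommGroup E] {C : Set E} (δ : ℝ) (S : C → C) : Prop :=
  ∀ x y : C, ‖(S x : E) - S y‖ ^ 2 ≤
    ‖(x : E) - y‖ ^ 2 - δ * ‖((x : E) - y) - ((S x : E) - S y)‖ ^ 2

theorem IsAveraged.norm_sub_le {E : Type*} [NormedAddCommGroup E] {C : Set E} {S : C → C} {δ : ℝ}
    (hS : IsAveraged δ S) (hδ : 0 ≤ δ) (x y : C) :
    ‖(S x : E) - S y‖ ≤ ‖(x : E) - y‖ := by
  refine le_of_sq_le_sq ?_ (norm_nonneg _)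
  have : 0 ≤ δ * ‖((x : E) - y) - ((S x : E) - S y)‖ ^ 2 := by positivity
  linarith [hS x y]

/-- `p` solves `p = t u + (1 - t) S p`. -/
def IsAnchoredPoint {E : Type*} [NormedAddCommGroup E] [NormedSpace ℝ E] {C : Set E} (S : C → C)
    (u : C) (t : ℝ) (p : C) : Prop :=
  (p : E) = t • (u : E) + (1 - t) • (S p : E)

/-! ### The anchored curve of a nonexpansive map: existence and estimates. -/

section AnchoredCurve

variable {E : Type*} [NormedAddCommGroup E] [NormedSpace ℝ E] {C : Set E} {S : C → C}
  {K : ℝ} {u : C}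

theorem existsUnique_isAnchoredPoint [CompleteSpace E] (hcl : IsClosed C) (hC : Convex ℝ C)
    (hS : ∀ x y : C, ‖(S x : E) - S y‖ ≤ ‖(x : E) - y‖) (u : C) {t : ℝ} (ht : t ∈ Ioo (0 : ℝ) 1) :
    ∃ y : C, ∀ p : C, IsAnchoredPoint S u t p ↔ p = y := by
  have : CompleteSpace C := hcl.completeSpace_coe
  have : Nonempty C := ⟨u⟩
  have h1t : 0 ≤ 1 - t := by linarith [ht.2]
  let f : C → C := fun p => ⟨t • (u : E) + (1 - t) • (S p : E),
    hC u.2 (S p).2 ht.1.le h1t (by ring)⟩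
  have hf : ContractingWith (1 - t).toNNReal f := by
    refine ⟨by rw [Real.toNNReal_lt_one]; linarith [ht.1], LipschitzWith.of_dist_le_mul ?_⟩
    intro x y
    rw [Real.coe_toNNReal _ h1t, Subtype.dist_eq, Subtype.dist_eq, dist_eq_norm, dist_eq_norm]
    simp only [f, add_sub_add_left_eq_sub, ← smul_sub, norm_smul, Real.norm_of_nonneg h1t]
    exact mul_le_mul_of_nonneg_left (hS x y) h1t
  have hiff : ∀ p : C, IsAnchoredPoint S u t p ↔ Function.IsFixedPt f p := fun p =>
    ⟨fun h => Subtype.ext h.symm, fun h => (congrArg Subtype.val h).symm⟩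
  refine ⟨ContractingWith.fixedPoint f hf, fun p => ⟨fun h => ?_, ?_⟩⟩
  · exact hf.fixedPoint_unique ((hiff p).1 h)
  · rintro rfl
    exact (hiff _).2 hf.fixedPoint_isFixedPt

theorem IsAnchoredPoint.norm_sub_fixed_le (hS : ∀ x y : C, ‖(S x : E) - S y‖ ≤ ‖(x : E) - y‖)
    {t : ℝ} (ht : t ∈ Ioo (0 : ℝ) 1) {q : C} (hq : IsAnchoredPoint S u t q) {p : C} (hp : S p = p) :
    ‖(q : E) - p‖ ≤ ‖(u : E) - p‖ := by
  have h1t : 0 ≤ 1 - t := by linarith [ht.2]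
  have h1 : (q : E) - p = t • ((u : E) - p) + (1 - t) • ((S q : E) - p) := by
    nth_rw 1 [hq]; module
  have h2 : ‖(q : E) - p‖ ≤ t * ‖(u : E) - p‖ + (1 - t) * ‖(S q : E) - p‖ := by
    nth_rw 1 [h1]
    refine (norm_add_le _ _).trans ?_
    rw [norm_smul, norm_smul, Real.norm_of_nonneg ht.1.le, Real.norm_of_nonneg h1t]
  have h3 := hS q p
  rw [hp] at h3
  have h4 := mul_le_mul_of_nonneg_left h3 h1t
  have : t * ‖(q : E) - p‖ ≤ t * ‖(u : E) - p‖ := by linarith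
  exact le_of_mul_le_mul_left this ht.1

theorem IsAnchoredPoint.norm_sub_apply_le (hS : ∀ x y : C, ‖(S x : E) - S y‖ ≤ ‖(x : E) - y‖)
    {t : ℝ} (ht : t ∈ Ioo (0 : ℝ) 1) {q : C} (hq : IsAnchoredPoint S u t q) {p : C} (hp : S p = p) :
    ‖(q : E) - S q‖ ≤ t * (2 * ‖(u : E) - p‖) := by
  have h1 : (q : E) - S q = t • ((u : E) - S q) := by
    nth_rw 1 [hq]; module
  rw [h1, norm_smul, Real.norm_of_nonneg ht.1.le]
  refine mul_le_mul_of_nonneg_left ?_ ht.1.le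
  have h2 := hS q p
  rw [hp] at h2
  have h3 := norm_sub_le_norm_sub_add_norm_sub (u : E) p (S q)
  rw [norm_sub_rev (p : E)] at h3
  linarith [hq.norm_sub_fixed_le hS ht hp]

/-- This is accretivity of `I - S`, applied to `t (q - u) = (1 - t) (S q - q)`. At a fixed point `w`
the right-hand side is zero. -/
theorem IsAnchoredPoint.apply_sub_le (hS : ∀ x y : C, ‖(S x : E) - S y‖ ≤ ‖(x : E) - y‖)
    {t : ℝ} (ht : t ∈ Ioo (0 : ℝ) 1) {q : C} (hq : IsAnchoredPoint S u t q) (w : C)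
    {j : StrongDual ℝ E} (hj : j ∈ normalizedDuality ((q : E) - w)) :
    t * j ((q : E) - u) ≤ ‖(w : E) - S w‖ * ‖(q : E) - w‖ := by
  have h1t : 0 ≤ 1 - t := by linarith [ht.2]
  have h1 : t • ((q : E) - u) = (1 - t) • (((S q : E) - S w) + ((S w : E) - w) -
      ((q : E) - w)) := by
    have : t • (q : E) = (q : E) - (1 - t) • (q : E) := by module
    rw [smul_sub, this]
    nth_rw 1 [hq]; module
  have h2 : t * j ((q : E) - u) = (1 - t) * (j ((S q : E) - S w) + j ((S w : E) - w) -
      ‖(q : E) - w‖ ^ 2) := by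
    rw [← smul_eq_mul, ← map_smul, h1, map_smul, map_sub, map_add, smul_eq_mul,
      normalizedDuality.apply_self hj]
  have h3 := normalizedDuality.apply_le hj ((S q : E) - S w)
  have h4 := normalizedDuality.apply_le hj ((S w : E) - w)
  rw [norm_sub_rev (S w : E)] at h4
  have h5 := mul_le_mul_of_nonneg_left (hS q w) (norm_nonneg ((q : E) - w))
  rw [h2]
  have h6 : j ((S q : E) - S w) + j ((S w : E) - w) - ‖(q : E) - w‖ ^ 2 ≤
      ‖(w : E) - S w‖ * ‖(q : E) - w‖ := by nlinarith
  have h7 : 0 ≤ ‖(w : E) - S w‖ * ‖(q : E) - w‖ := by positivity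
  nlinarith [ht.1]

/-- Transfers the previous bound from `q` to a nearby `v`, although the functional changes with the
point. The subgradient inequality at `v - w` and the smoothness inequality at `q - w` bracket two
squared norms that differ by `O(‖q - v‖)`; the price is a term quadratic in `s`. -/
theorem IsAnchoredPoint.smul_apply_sub_le (hK : HasSmoothnessConstant E K)
    (hS : ∀ x y : C, ‖(S x : E) - S y‖ ≤ ‖(x : E) - y‖)
    {t : ℝ} (ht : t ∈ Ioo (0 : ℝ) 1) {q : C} (hq : IsAnchoredPoint S u t q)
    {s : ℝ} (hs : s ∈ Ioc (0 : ℝ) 1) {v w : C} {M : ℝ}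
    (hqw : ‖(q : E) - w‖ ≤ M) (hqu : ‖(q : E) - u‖ ≤ M)
    (hvw : ‖(v : E) - w‖ ≤ M) (hvu : ‖(v : E) - u‖ ≤ M)
    {j : StrongDual ℝ E} (hj : j ∈ normalizedDuality ((v : E) - w)) :
    s * j ((v : E) - u) ≤ 5 * M * ‖(q : E) - v‖ + s * (‖(w : E) - S w‖ * M / t) +
      K ^ 2 * s ^ 2 * M ^ 2 := by
  have hM : 0 ≤ M := (norm_nonneg _).trans hqw
  obtain ⟨i, hi⟩ := normalizedDuality_nonempty ((q : E) - w)
  have h1 := hK _ (s • ((q : E) - u)) i hi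
  have h2 := normalizedDuality.le_norm_add_sq hj (s • ((v : E) - u))
  rw [map_smul, smul_eq_mul] at h1 h2
  have h3 : i ((q : E) - u) ≤ ‖(w : E) - S w‖ * M / t := by
    rw [le_div_iff₀ ht.1, mul_comm]
    exact (hq.apply_sub_le hS ht w hi).trans (mul_le_mul_of_nonneg_left hqw (norm_nonneg _))
  have hsn : ∀ a : E, ‖s • a‖ = s * ‖a‖ := fun a => by
    rw [norm_smul, Real.norm_of_nonneg hs.1.le]
  have h4 : ‖s • ((q : E) - u)‖ ^ 2 ≤ s ^ 2 * M ^ 2 := by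
    rw [hsn, mul_pow]
    gcongr
  have hbd : ∀ a : E, ‖a‖ ≤ M → ‖s • a‖ ≤ M := fun a ha => by
    rw [hsn]
    exact (mul_le_of_le_one_left (norm_nonneg _) hs.2).trans ha
  have hA : ‖(v : E) - w + s • ((v : E) - u)‖ ≤ 2 * M :=
    (norm_add_le _ _).trans (by linarith [hbd _ hvu])
  have hB : ‖(q : E) - w + s • ((q : E) - u)‖ ≤ 2 * M :=
    (norm_add_le _ _).trans (by linarith [hbd _ hqu])
  have he := norm_nonneg ((q : E) - v)
  have hAB : ‖(v : E) - w + s • ((v : E) - u)‖ ≤ ‖(q : E) - w + s • ((q : E) - u)‖ +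
      2 * ‖(q : E) - v‖ := by
    have e1 : (v : E) - w + s • ((v : E) - u) = ((q : E) - w + s • ((q : E) - u)) -
        (((q : E) - v) + s • ((q : E) - v)) := by module
    rw [e1]
    refine (norm_sub_le _ _).trans ?_
    have := norm_add_le ((q : E) - v) (s • ((q : E) - v))
    rw [hsn] at this
    have := mul_le_of_le_one_left he hs.2
    linarith
  have hAB2 : ‖(v : E) - w + s • ((v : E) - u)‖ ^ 2 ≤ ‖(q : E) - w + s • ((q : E) - u)‖ ^ 2 +
      8 * M * ‖(q : E) - v‖ := by
    have := norm_nonneg ((v : E) - w + s • ((v : E) - u))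
    have := norm_nonneg ((q : E) - w + s • ((q : E) - u))
    nlinarith
  have hqv : ‖(q : E) - w‖ ^ 2 ≤ ‖(v : E) - w‖ ^ 2 + 2 * M * ‖(q : E) - v‖ := by
    have := norm_sub_le_norm_sub_add_norm_sub (q : E) v w
    have := norm_nonneg ((v : E) - w)
    have := norm_nonneg ((q : E) - w)
    nlinarith
  have h5 := mul_le_mul_of_nonneg_left h3 hs.1.le
  have h6 := mul_le_mul_of_nonneg_left h4 (sq_nonneg K)
  nlinarith

end AnchoredCurve

/-! ### Strong convergence of the anchored curve. -/

section AnchoredCurveLimit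

variable {E : Type*} [NormedAddCommGroup E] [NormedSpace ℝ E] {C : Set E} {S : C → C}
  {δ K : ℝ} {u : C} {y : ℝ → C}

/-- Cluster points of the anchored curve satisfy the variational inequality characterising the
sunny nonexpansive retraction of `u` onto the fixed points of `S`. -/
theorem apply_sub_nonpos_of_tendsto_anchored (hK : HasSmoothnessConstant E K)
    (hS : ∀ x y : C, ‖(S x : E) - S y‖ ≤ ‖(x : E) - y‖)
    (hy : ∀ t ∈ Ioo (0 : ℝ) 1, IsAnchoredPoint S u t (y t))
    {l : Filter ℝ} [l.NeBot] (hl : l ≤ 𝓝[>] 0) {v : C} (hv : Tendsto y l (𝓝 v))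
    {p : C} (hp : S p = p) {j : StrongDual ℝ E} (hj : j ∈ normalizedDuality ((v : E) - p)) :
    j ((v : E) - u) ≤ 0 := by
  have hIoo : ∀ᶠ t in l, t ∈ Ioo (0 : ℝ) 1 := hl (Ioo_mem_nhdsGT one_pos)
  set M := 2 * ‖(u : E) - p‖ + ‖(v : E) - p‖ + ‖(v : E) - u‖
  have h0 := norm_nonneg ((u : E) - p)
  have h0' := norm_nonneg ((v : E) - p)
  have h0'' := norm_nonneg ((v : E) - u)
  have hvE : Tendsto (fun t => ‖(y t : E) - v‖) l (𝓝 0) := by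
    have := (continuous_subtype_val.tendsto v).comp hv
    simpa using (this.sub_const (v : E)).norm
  -- The limit in `t` is taken with `s` fixed; dividing by `s` and letting `s → 0` then removes the
  -- quadratic term.
  have key : ∀ s ∈ Ioc (0 : ℝ) 1, j ((v : E) - u) ≤ K ^ 2 * M ^ 2 * s := by
    intro s hs
    have h1 : s * j ((v : E) - u) ≤ 5 * M * 0 + K ^ 2 * s ^ 2 * M ^ 2 := by
      refine ge_of_tendsto ((hvE.const_mul (5 * M)).add_const _) ?_
      filter_upwards [hIoo] with t ht
      have hqp := (hy t ht).norm_sub_fixed_le hS ht hp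
      have hqu := norm_sub_le_norm_sub_add_norm_sub (y t : E) p u
      rw [norm_sub_rev (p : E)] at hqu
      have := (hy t ht).smul_apply_sub_le hK hS ht hs (v := v) (w := p) (M := M)
        (by linarith) (by linarith) (by linarith) (by linarith) hj
      simpa [hp] using this
    have h2 : s * j ((v : E) - u) ≤ s * (K ^ 2 * M ^ 2 * s) := by linarith
    exact le_of_mul_le_mul_left h2 hs.1
  have hlim : Tendsto (fun s : ℝ => K ^ 2 * M ^ 2 * s) (𝓝[>] 0) (𝓝 (K ^ 2 * M ^ 2 * 0)) :=
    (tendsto_id.const_mul _).mono_left nhdsWithin_le_nhds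
  rw [mul_zero] at hlim
  refine ge_of_tendsto hlim ?_
  filter_upwards [Ioc_mem_nhdsGT one_pos] with s hs using key s hs

theorem exists_tendsto_anchored_of_ultrafilter
    (hrefl : Function.Surjective (NormedSpace.inclusionInDoubleDual ℝ E))
    (hK : HasSmoothnessConstant E K) (hcl : IsClosed C) (hC : Convex ℝ C)
    (hδ : 0 < δ) (hS : IsAveraged δ S) (hfix : ∃ p, S p = p)
    (hy : ∀ t ∈ Ioo (0 : ℝ) 1, IsAnchoredPoint S u t (y t))
    {U : Ultrafilter ℝ} (hU : (U : Filter ℝ) ≤ 𝓝[>] 0) :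
    ∃ v : C, S v = v ∧ Tendsto y U (𝓝 v) := by
  have hne := hS.norm_sub_le hδ.le
  obtain ⟨p, hp⟩ := hfix
  have hIoo : ∀ᶠ t in (U : Filter ℝ), t ∈ Ioo (0 : ℝ) 1 := hU (Ioo_mem_nhdsGT one_pos)
  obtain ⟨g, hg, v, hvC, hmin⟩ := exists_asymptoticCenter hrefl hC hcl ⟨u, u.2⟩ U
    (fun t => (y t : E)) (M := ‖(u : E) - p‖ + ‖(p : E)‖) (by
      filter_upwards [hIoo] with t ht
      have := (hy t ht).norm_sub_fixed_le hne ht hp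
      have := norm_sub_norm_le (y t : E) p
      linarith)
  have hg0 : 0 ≤ g v := ge_of_tendsto' (hg v) fun _ => norm_nonneg _
  lift v to C using hvC
  -- displacement tends to zero
  have hdisp : Tendsto (fun t => (y t : E) - S (y t)) U (𝓝 0) := by
    have h0 : Tendsto (fun t : ℝ => t * (2 * ‖(u : E) - p‖)) U (𝓝 0) := by
      have := ((tendsto_id (α := ℝ) (x := 𝓝 0)).mul_const (2 * ‖(u : E) - p‖)).mono_left
        (hU.trans nhdsWithin_le_nhds)
      simpa using this
    refine squeeze_zero_norm' ?_ h0
    filter_upwards [hIoo] with t ht using (hy t ht).norm_sub_apply_le hne ht hp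
  -- In the limit, averagedness reads `g (S v) ^ 2 ≤ g v ^ 2 - δ ‖S v - v‖ ^ 2`, whereas `g v ≤ g (S
  -- v)` by minimality.
  have hv : S v = v := by
    have h1 : Tendsto (fun t => ‖(S (y t) : E) - S v‖) U (𝓝 (g (S v))) := by
      have : Tendsto (fun t => ‖(S (y t) : E) - S v‖ - ‖(y t : E) - S v‖) U (𝓝 0) := by
        refine squeeze_zero_norm (fun t => ?_) (by simpa using hdisp.norm)
        rw [Real.norm_eq_abs]
        refine (abs_norm_sub_norm_le _ _).trans_eq ?_
        rw [norm_sub_rev]; congr 1; abel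
      simpa using this.add (hg (S v))
    have h2 : Tendsto (fun t => ‖((y t : E) - v) - ((S (y t) : E) - S v)‖) U
        (𝓝 ‖(S v : E) - v‖) := by
      have := (hdisp.add_const ((S v : E) - v)).norm
      rw [zero_add] at this
      refine this.congr fun t => ?_
      congr 1; abel
    have h3 := le_of_tendsto_of_tendsto' (h1.pow 2)
      (((hg v).pow 2).sub ((h2.pow 2).const_mul δ)) fun t => hS (y t) v
    have h4 := pow_le_pow_left₀ hg0 (hmin _ (S v).2) 2
    have h5 : ‖(S v : E) - v‖ ^ 2 ≤ 0 := by nlinarith [sq_nonneg ‖(S v : E) - v‖]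
    have h6 : ‖(S v : E) - v‖ = 0 := pow_eq_zero_iff (two_ne_zero) |>.1
      (le_antisymm h5 (sq_nonneg _))
    exact Subtype.ext (sub_eq_zero.1 (norm_eq_zero.1 h6))
  refine ⟨v, hv, ?_⟩
  -- Minimality is tested at `v + s (u - v)`. As `v` is fixed, `i (u - v) ≥ ‖y t - v‖ ^ 2`, so this
  -- move lowers `g ^ 2` by `2 s (g v) ^ 2` up to `O(s ^ 2)`, which forces `g v = 0`.
  have key : ∀ s ∈ Ioc (0 : ℝ) 1, g v ^ 2 ≤ K ^ 2 * ‖(u : E) - v‖ ^ 2 * s := by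
    intro s hs
    have hmem : (v : E) + s • ((u : E) - v) ∈ C := hC.add_smul_sub_mem v.2 u.2 ⟨hs.1.le, hs.2⟩
    have h1 : g v ^ 2 ≤ g ((v : E) + s • ((u : E) - v)) ^ 2 :=
      pow_le_pow_left₀ hg0 (hmin _ hmem) 2
    have h2 : g ((v : E) + s • ((u : E) - v)) ^ 2 ≤
        (1 - 2 * s) * g v ^ 2 + 2 * K ^ 2 * (s ^ 2 * ‖(u : E) - v‖ ^ 2) := by
      refine le_of_tendsto_of_tendsto ((hg _).pow 2) ((((hg v).pow 2).const_mul _).add_const _) ?_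
      filter_upwards [hIoo] with t ht
      obtain ⟨i, hi⟩ := normalizedDuality_nonempty ((y t : E) - v)
      have h3 := hK _ (-(s • ((u : E) - v))) i hi
      have h4 := (hy t ht).apply_sub_le hne ht v hi
      rw [hv, sub_self, norm_zero, zero_mul] at h4
      have h5 : i ((y t : E) - u) ≤ 0 := nonpos_of_mul_nonpos_right h4 ht.1
      have h6 : i ((u : E) - v) = ‖(y t : E) - v‖ ^ 2 - i ((y t : E) - u) := by
        rw [← normalizedDuality.apply_self hi, ← map_sub]; congr 1; abel
      rw [map_neg, map_smul, smul_eq_mul, norm_neg, norm_smul, mul_pow, Real.norm_eq_abs, sq_abs,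
        h6] at h3
      rw [show (y t : E) - (v + s • ((u : E) - v)) = (y t : E) - v + -(s • ((u : E) - v)) by abel]
      have := mul_nonpos_of_nonneg_of_nonpos hs.1.le h5
      linarith
    have h7 : s * g v ^ 2 ≤ s * (K ^ 2 * ‖(u : E) - v‖ ^ 2 * s) := by linarith
    exact le_of_mul_le_mul_left h7 hs.1
  have hlim : Tendsto (fun s : ℝ => K ^ 2 * ‖(u : E) - v‖ ^ 2 * s) (𝓝[>] 0)
      (𝓝 (K ^ 2 * ‖(u : E) - v‖ ^ 2 * 0)) :=
    (tendsto_id.const_mul _).mono_left nhdsWithin_le_nhds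
  rw [mul_zero] at hlim
  have hgv : g v ^ 2 ≤ 0 := by
    refine ge_of_tendsto hlim ?_
    filter_upwards [Ioc_mem_nhdsGT one_pos] with s hs using key s hs
  have hgv0 : g v = 0 := pow_eq_zero_iff two_ne_zero |>.1 (le_antisymm hgv (sq_nonneg _))
  rw [tendsto_subtype_rng, tendsto_iff_norm_sub_tendsto_zero, ← hgv0]
  exact hg v

/-- Two ultrafilter limits `v`, `z` are both fixed points, so each can be used in the variational
inequality of the other; adding the two gives `‖v - z‖ ^ 2 ≤ 0`. -/
theorem exists_tendsto_anchored
    (hrefl : Function.Surjective (NormedSpace.inclusionInDoubleDual ℝ E))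
    (hK : HasSmoothnessConstant E K) (hcl : IsClosed C) (hC : Convex ℝ C)
    (hδ : 0 < δ) (hS : IsAveraged δ S) (hfix : ∃ p, S p = p)
    (hy : ∀ t ∈ Ioo (0 : ℝ) 1, IsAnchoredPoint S u t (y t)) :
    ∃ z : C, S z = z ∧ Tendsto y (𝓝[>] 0) (𝓝 z) := by
  have hne := hS.norm_sub_le hδ.le
  obtain ⟨z, hz, hzlim⟩ := exists_tendsto_anchored_of_ultrafilter hrefl hK hcl hC hδ hS hfix hy
    (Ultrafilter.of_le (𝓝[>] (0 : ℝ)))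
  refine ⟨z, hz, (tendsto_iff_ultrafilter _ _ _).2 fun U hU => ?_⟩
  obtain ⟨v, hv, hvlim⟩ := exists_tendsto_anchored_of_ultrafilter hrefl hK hcl hC hδ hS hfix hy hU
  obtain ⟨j, hj⟩ := normalizedDuality_nonempty ((v : E) - z)
  have h1 := apply_sub_nonpos_of_tendsto_anchored hK hne hy hU hvlim hz hj
  have hj' := normalizedDuality.neg_mem hj
  rw [neg_sub] at hj'
  have h2 := apply_sub_nonpos_of_tendsto_anchored hK hne hy
    (Ultrafilter.of_le (𝓝[>] (0 : ℝ))) hzlim hv hj'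
  have h3 : ‖(v : E) - z‖ ^ 2 = j ((v : E) - u) + (-j) ((z : E) - u) := by
    rw [← normalizedDuality.apply_self hj, neg_apply, ← sub_eq_add_neg, ← map_sub]
    congr 1; abel
  have h4 : ‖(v : E) - z‖ = 0 := pow_eq_zero_iff two_ne_zero |>.1
    (le_antisymm (by linarith) (sq_nonneg _))
  rwa [show v = z from Subtype.ext (sub_eq_zero.1 (norm_eq_zero.1 h4))] at hvlim

/-- The variational inequality at the limit of the anchored curve holds approximately at
approximate fixed points, uniformly on bounded sets. -/
theorem exists_forall_apply_sub_le (hK : HasSmoothnessConstant E K)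
    (hS : ∀ x y : C, ‖(S x : E) - S y‖ ≤ ‖(x : E) - y‖)
    (hy : ∀ t ∈ Ioo (0 : ℝ) 1, IsAnchoredPoint S u t (y t))
    {z : C} (hz : S z = z) (hlim : Tendsto y (𝓝[>] 0) (𝓝 z)) (R : ℝ) {ε : ℝ} (hε : 0 < ε) :
    ∃ η > 0, ∀ w : C, ‖(w : E) - z‖ ≤ R → ‖(w : E) - S w‖ ≤ η →
      ∀ j ∈ normalizedDuality ((w : E) - z), j ((u : E) - z) ≤ ε := by
  set M := 2 * ‖(u : E) - z‖ + |R| + 1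
  have h0 := norm_nonneg ((u : E) - z)
  have hMpos : 0 < M := by positivity
  -- The parameters are chosen in the order `s`, `t`, `η`, so that each of the three error terms of
  -- `smul_apply_sub_le` is at most `s * (ε / 3)`.
  obtain ⟨s, hs, hsε⟩ : ∃ s ∈ Ioc (0 : ℝ) 1, K ^ 2 * M ^ 2 * s < ε / 3 := by
    have hlim : Tendsto (fun s : ℝ => K ^ 2 * M ^ 2 * s) (𝓝[>] 0) (𝓝 (K ^ 2 * M ^ 2 * 0)) :=
      (tendsto_id.const_mul _).mono_left nhdsWithin_le_nhds
    rw [mul_zero] at hlim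
    exact ((eventually_mem_set.2 (Ioc_mem_nhdsGT one_pos)).and
      (hlim.eventually_lt_const (by positivity : 0 < ε / 3))).exists
  have hzE : Tendsto (fun t => 5 * M * ‖(y t : E) - z‖) (𝓝[>] 0) (𝓝 0) := by
    have := (continuous_subtype_val.tendsto z).comp hlim
    simpa using ((this.sub_const (z : E)).norm).const_mul (5 * M)
  obtain ⟨t, ht, htε⟩ : ∃ t ∈ Ioo (0 : ℝ) 1, 5 * M * ‖(y t : E) - z‖ < s * (ε / 3) :=
    ((eventually_mem_set.2 (Ioo_mem_nhdsGT one_pos)).and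
      (hzE.eventually_lt_const (mul_pos hs.1 (by positivity : 0 < ε / 3)))).exists
  refine ⟨ε / 3 * t / M, by have := ht.1; positivity, fun w hwR hwη j hj => ?_⟩
  have hqz := (hy t ht).norm_sub_fixed_le hS ht hz
  have hqu := norm_sub_le_norm_sub_add_norm_sub (y t : E) z u
  have hqw := norm_sub_le_norm_sub_add_norm_sub (y t : E) z w
  rw [norm_sub_rev (z : E)] at hqu hqw
  have hR := le_abs_self R
  have hR0 := abs_nonneg R
  have hj' := normalizedDuality.neg_mem hj
  rw [neg_sub] at hj'
  have h1 := (hy t ht).smul_apply_sub_le hK hS ht hs (v := z) (w := w) (M := M)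
    (by linarith) (by linarith) (by rw [norm_sub_rev]; linarith) (by rw [norm_sub_rev]; linarith)
    hj'
  have h2 : ‖(w : E) - S w‖ * M / t ≤ ε / 3 := by
    rw [div_le_iff₀ ht.1, ← le_div_iff₀ hMpos]
    exact hwη
  have h3 : (-j) ((z : E) - u) = j ((u : E) - z) := by
    rw [neg_apply, ← map_neg, neg_sub]
  rw [h3] at h1
  have h4 := mul_le_mul_of_nonneg_left h2 hs.1.le
  have h5 := mul_le_mul_of_nonneg_left hsε.le hs.1.le
  refine le_of_mul_le_mul_left (a := s) ?_ hs.1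
  nlinarith

end AnchoredCurveLimit

/-- A nonnegative sequence with `a (n + 1) ≤ (1 - β n) a n + β n ε` eventually, for every `ε > 0`,
tends to zero if `∑ β n = ∞`. -/
theorem tendsto_zero_of_eventually_succ_le {a β : ℕ → ℝ} (ha : ∀ n, 0 ≤ a n)
    (hβ : ∀ n, β n ≤ 1) (hsum : Tendsto (fun n => ∑ i ∈ Finset.range n, β i) atTop atTop)
    (h : ∀ ε > 0, ∀ᶠ n in atTop, a (n + 1) ≤ (1 - β n) * a n + β n * ε) :
    Tendsto a atTop (𝓝 0) := by
  rw [Metric.tendsto_nhds]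
  intro ε hε
  obtain ⟨N, hN⟩ := eventually_atTop.1 (h (ε / 2) (half_pos hε))
  set s : ℕ → ℝ := fun n => ∑ i ∈ Finset.range n, β i with hs
  -- Discrete Grönwall bound, using `1 - β ≤ exp (-β)`.
  have hbd : ∀ n, N ≤ n → a n ≤ ε / 2 + a N * Real.exp (-(s n - s N)) := by
    intro n hn
    induction n, hn using Nat.le_induction with
    | base => simp; linarith
    | succ n hn ih =>
      have h1 : s (n + 1) = s n + β n := Finset.sum_range_succ _ _
      have h2 : Real.exp (-(s (n + 1) - s N)) = Real.exp (-β n) * Real.exp (-(s n - s N)) := by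
        rw [← Real.exp_add, h1]; congr 1; ring
      have h3 : 1 - β n ≤ Real.exp (-β n) := by linarith [Real.add_one_le_exp (-β n)]
      have h4 : 0 ≤ a N * Real.exp (-(s n - s N)) := mul_nonneg (ha N) (Real.exp_nonneg _)
      have h5 := mul_le_mul_of_nonneg_left ih (sub_nonneg.2 (hβ n))
      have h6 := mul_le_mul_of_nonneg_right h3 h4
      rw [h2]
      linarith [hN n hn]
  have hlim : Tendsto (fun n => a N * Real.exp (-(s n - s N))) atTop (𝓝 (a N * 0)) :=
    (Real.tendsto_exp_neg_atTop_nhds_zero.comp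
      (tendsto_atTop_add_const_right _ (-s N) hsum)).const_mul _
  rw [mul_zero] at hlim
  filter_upwards [hlim.eventually_lt_const (half_pos hε), eventually_ge_atTop N] with n h1 h2
  rw [Real.dist_0_eq_abs, abs_of_nonneg (ha n)]
  linarith [hbd n h2]

/-! ### Strict pseudocontractions and the anchored iteration. -/

section StrictPseudocontraction

variable {E : Type*} [NormedAddCommGroup E] [NormedSpace ℝ E] {C : Set E} {T S : C → C}
  {lam K : ℝ} {u z : C}

/-- With `D = (x - y) - (T x - T y)`, strict pseudocontractivity says `j D ≥ lam ‖D‖ ^ 2`. The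
smoothness inequality with increment `-a D` gains `2 a lam ‖D‖ ^ 2` from this and loses `2 K ^ 2 a ^
2 ‖D‖ ^ 2`. -/
theorem IsStrictPseudocontraction.norm_sub_smul_sq_le (hK : HasSmoothnessConstant E K)
    (hT : IsStrictPseudocontraction lam T) {a : ℝ} (ha : 0 ≤ a) (x y : C) :
    ‖((x : E) - y) - a • (((x : E) - y) - ((T x : E) - T y))‖ ^ 2 ≤
      ‖(x : E) - y‖ ^ 2 -
        2 * (a * (lam - K ^ 2 * a)) * ‖((x : E) - y) - ((T x : E) - T y)‖ ^ 2 := by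
  obtain ⟨j, hj, h⟩ := hT.2 x y
  have h1 := hK _ (-(a • (((x : E) - y) - ((T x : E) - T y)))) j hj
  rw [← sub_eq_add_neg, map_neg, map_smul, smul_eq_mul, norm_neg, norm_smul, mul_pow,
    Real.norm_eq_abs, sq_abs, map_sub j, normalizedDuality.apply_self hj] at h1
  have h2 := mul_le_mul_of_nonneg_left h ha
  linarith

theorem IsStrictPseudocontraction.isAveraged (hK : HasSmoothnessConstant E K)
    (hT : IsStrictPseudocontraction lam T) {a : ℝ} (ha : 0 < a)
    (hS : ∀ x, (S x : E) = a • (T x : E) + (1 - a) • (x : E)) :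
    IsAveraged (2 * (lam - K ^ 2 * a) / a) S := by
  intro x y
  have h1 := hT.norm_sub_smul_sq_le hK ha.le x y
  have e1 : (S x : E) - S y = ((x : E) - y) - a • (((x : E) - y) - ((T x : E) - T y)) := by
    rw [hS, hS]; module
  have e2 : ((x : E) - y) - ((S x : E) - S y) = a • (((x : E) - y) - ((T x : E) - T y)) := by
    rw [e1]; abel
  rw [e2, norm_smul, mul_pow, Real.norm_eq_abs, sq_abs, e1]
  refine h1.trans_eq ?_
  field_simp

/-- The first estimate bounds the orbit. The second uses the subgradient inequality at the new point
`x'`, so that `j` is dual to `x' - z`, and convexity of the square. -/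
theorem IsStrictPseudocontraction.norm_sub_sq_le_of_anchored (hK : HasSmoothnessConstant E K)
    (hT : IsStrictPseudocontraction lam T) (hz : T z = z) {a b c : ℝ} (ha : 0 ≤ a) (hb : 0 ≤ b)
    (hc : 0 ≤ c) (hbc : b + c ≤ 1) (haK : K ^ 2 * a ≤ lam) {x x' : C}
    (hx : (x' : E) = b • (u : E) + c • (x : E) + (1 - b - c) • (a • (T x : E) + (1 - a) • (x : E))) :
    ‖(x' : E) - z‖ ≤ b * ‖(u : E) - z‖ + (1 - b) * ‖(x : E) - z‖ ∧
    ∀ j ∈ normalizedDuality ((x' : E) - z),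
      ‖(x' : E) - z‖ ^ 2 ≤ (1 - b) * ‖(x : E) - z‖ ^ 2 -
        (1 - b) * (1 - b - c) * (2 * (a * (lam - K ^ 2 * a)) * ‖(x : E) - T x‖ ^ 2) +
        2 * b * j ((u : E) - z) := by
  have hθ : 0 ≤ 1 - b - c := by linarith
  have h1 := hT.norm_sub_smul_sq_le hK ha x z
  set V : E := a • (T x : E) + (1 - a) • (x : E) - z with hV
  rw [hz, show ((x : E) - z) - ((T x : E) - z) = (x : E) - T x by abel,
    show ((x : E) - z) - a • ((x : E) - T x) = V by rw [hV]; module] at h1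
  set r := 2 * (a * (lam - K ^ 2 * a)) * ‖(x : E) - T x‖ ^ 2
  have hr : 0 ≤ r := by
    have : 0 ≤ lam - K ^ 2 * a := by linarith
    positivity
  have hVx : ‖V‖ ≤ ‖(x : E) - z‖ := le_of_sq_le_sq (by linarith) (norm_nonneg _)
  set W : E := c • ((x : E) - z) + (1 - b - c) • V with hWdef
  have hW : ‖W‖ ≤ c * ‖(x : E) - z‖ + (1 - b - c) * ‖V‖ := by
    refine (norm_add_le _ _).trans ?_
    rw [norm_smul, norm_smul, Real.norm_of_nonneg hc, Real.norm_of_nonneg hθ]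
  have hx' : (x' : E) - z = b • ((u : E) - z) + W := by
    rw [hx, hWdef, hV]; module
  refine ⟨?_, fun j hj => ?_⟩
  · rw [hx']
    refine (norm_add_le _ _).trans ?_
    rw [norm_smul, Real.norm_of_nonneg hb]
    have := mul_le_mul_of_nonneg_left hVx hθ
    linarith
  · have h2 := normalizedDuality.le_norm_add_sq hj (-(b • ((u : E) - z)))
    rw [map_neg, map_smul, smul_eq_mul] at h2
    rw [show (x' : E) - z + -(b • ((u : E) - z)) = W by rw [hx']; abel] at h2
    have h3 : ‖W‖ ^ 2 ≤ (c * ‖(x : E) - z‖ + (1 - b - c) * ‖V‖) ^ 2 :=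
      pow_le_pow_left₀ (norm_nonneg _) hW 2
    have h4 : (c * ‖(x : E) - z‖ + (1 - b - c) * ‖V‖) ^ 2 ≤
        (1 - b) * (c * ‖(x : E) - z‖ ^ 2 + (1 - b - c) * ‖V‖ ^ 2) := by
      have := mul_nonneg (mul_nonneg hc hθ) (sq_nonneg (‖(x : E) - z‖ - ‖V‖))
      nlinarith
    have h5 := mul_le_mul_of_nonneg_left h1 (mul_nonneg (by linarith : 0 ≤ 1 - b) hθ)
    have h6 : (1 - b) * (1 - b) * ‖(x : E) - z‖ ^ 2 ≤ (1 - b) * ‖(x : E) - z‖ ^ 2 := by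
      refine mul_le_mul_of_nonneg_right ?_ (sq_nonneg _)
      nlinarith
    linarith

theorem IsStrictPseudocontraction.tendsto_anchored_iteration (hK : HasSmoothnessConstant E K)
    (hT : IsStrictPseudocontraction lam T) (hz : T z = z)
    {a : ℝ} (ha : a ∈ Icc (0 : ℝ) 1) (hSdef : ∀ x, (S x : E) = a • (T x : E) + (1 - a) • (x : E))
    (hS : ∀ x y : C, ‖(S x : E) - S y‖ ≤ ‖(x : E) - y‖)
    (hvar : ∀ (R ε : ℝ), 0 < ε → ∃ η > 0, ∀ w : C, ‖(w : E) - z‖ ≤ R → ‖(w : E) - S w‖ ≤ η →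
      ∀ j ∈ normalizedDuality ((w : E) - z), j ((u : E) - z) ≤ ε)
    {α β γ : ℕ → ℝ} (hα : ∀ n, α n ∈ Icc (0 : ℝ) 1) (hαK : ∀ n, K ^ 2 * α n ≤ lam)
    {κ : ℝ} (hκ : 0 < κ) (hακ : ∀ᶠ n in atTop, κ ≤ α n * (lam - K ^ 2 * α n))
    (hβ : ∀ n, β n ∈ Icc (0 : ℝ) 1) (hβ_lim : Tendsto β atTop (𝓝 0))
    (hβ_sum : Tendsto (fun n => ∑ i ∈ Finset.range n, β i) atTop atTop)
    (hγ : ∀ n, 0 ≤ γ n) {g : ℝ} (hg : g < 1) (hγg : ∀ᶠ n in atTop, γ n ≤ g)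
    {x : ℕ → C} (hx : ∀ n, (x (n + 1) : E) = β n • (u : E) + γ n • (x n : E) +
      (1 - β n - γ n) • (α n • (T (x n) : E) + (1 - α n) • (x n : E))) :
    Tendsto x atTop (𝓝 z) := by
  have hlt : ∀ δ : ℝ, 0 < δ → ∀ᶠ n in atTop, β n ≤ δ := fun δ hδ =>
    (hβ_lim.eventually_lt_const hδ).mono fun n hn => hn.le
  -- From `N` on, `1 - β n - γ n ≥ (1 - g) / 2` and `1 - β n ≥ 1 / 2`; the hypotheses do not give `β
  -- n + γ n ≤ 1` for earlier `n`.
  obtain ⟨N, hN⟩ := eventually_atTop.1 ((hακ.and hγg).and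
    ((hlt ((1 - g) / 2) (by linarith)).and (hlt (1 / 2) (by norm_num))))
  have hstep := fun n (hn : N ≤ n) => hT.norm_sub_sq_le_of_anchored hK hz (hα n).1 (hβ n).1 (hγ n)
    (by have := hN n hn; linarith [this.1.2, this.2.1]) (hαK n) (hx n)
  set R := max ‖(x N : E) - z‖ ‖(u : E) - z‖
  have hbdd : ∀ n, N ≤ n → ‖(x n : E) - z‖ ≤ R := by
    intro n hn
    induction n, hn using Nat.le_induction with
    | base => exact le_max_left _ _
    | succ n hn ih =>
      have h1 := mul_le_mul_of_nonneg_left (le_max_right ‖(x N : E) - z‖ ‖(u : E) - z‖) (hβ n).1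
      have h2 := mul_le_mul_of_nonneg_left ih (sub_nonneg.2 (hβ n).2)
      linarith [(hstep n hn).1]
  set D := R + ‖(u : E) - z‖
  have hD0 : 0 ≤ D := add_nonneg ((norm_nonneg _).trans (hbdd N le_rfl)) (norm_nonneg _)
  have hR0 : 0 ≤ R := (norm_nonneg _).trans (hbdd N le_rfl)
  set c := κ * (1 - g) / 2
  have hc : 0 < c := by have : 0 < 1 - g := by linarith
                        positivity
  have hsq : ∀ n, N ≤ n → ∀ j ∈ normalizedDuality ((x (n + 1) : E) - z),
      ‖(x (n + 1) : E) - z‖ ^ 2 ≤ (1 - β n) * ‖(x n : E) - z‖ ^ 2 -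
        c * ‖(x n : E) - T (x n)‖ ^ 2 + 2 * β n * j ((u : E) - z) := by
    intro n hn j hj
    obtain ⟨⟨h1, h2⟩, h3, h4⟩ := hN n hn
    have h5 : c ≤ (1 - β n) * (1 - β n - γ n) * (2 * (α n * (lam - K ^ 2 * α n))) := by
      have : (1 / 2) * ((1 - g) / 2) ≤ (1 - β n) * (1 - β n - γ n) :=
        mul_le_mul (by linarith) (by linarith) (by linarith) (by linarith)
      calc c = (1 / 2) * ((1 - g) / 2) * (2 * κ) := by ring
        _ ≤ _ := mul_le_mul this (by linarith) (by linarith)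
          (mul_nonneg (by linarith) (by linarith))
    have h6 := mul_le_mul_of_nonneg_right h5 (sq_nonneg ‖(x n : E) - T (x n)‖)
    linarith [(hstep n hn).2 j hj]
  -- The functional sits at `x (n + 1)`, while the negative term measures the displacement at `x n`;
  -- this bound links the two.
  have hdisp : ∀ n, N ≤ n → ‖(x (n + 1) : E) - S (x (n + 1))‖ ≤
      3 * ‖(x n : E) - T (x n)‖ + 2 * (β n * D) := by
    intro n hn
    obtain ⟨⟨-, h2⟩, h3, -⟩ := hN n hn
    have e1 : (x (n + 1) : E) - x n = β n • ((u : E) - x n) -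
        ((1 - β n - γ n) * α n) • ((x n : E) - T (x n)) := by
      rw [hx]; module
    have hcoef : (1 - β n - γ n) * α n ∈ Icc (0 : ℝ) 1 :=
      ⟨mul_nonneg (by linarith) (hα n).1,
        mul_le_one₀ (by linarith [hγ n, (hβ n).1]) (hα n).1 (hα n).2⟩
    have hux : ‖(u : E) - x n‖ ≤ D := by
      have := norm_sub_le_norm_sub_add_norm_sub (u : E) z (x n)
      rw [norm_sub_rev (z : E)] at this
      linarith [hbdd n hn]
    have h4 : ‖(x (n + 1) : E) - x n‖ ≤ β n * D + ‖(x n : E) - T (x n)‖ := by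
      rw [e1]
      refine (norm_sub_le _ _).trans (add_le_add ?_ ?_)
      · rw [norm_smul, Real.norm_of_nonneg (hβ n).1]
        exact mul_le_mul_of_nonneg_left hux (hβ n).1
      · rw [norm_smul, Real.norm_of_nonneg hcoef.1]
        exact mul_le_of_le_one_left (norm_nonneg _) hcoef.2
    have h5 : ‖(x n : E) - S (x n)‖ ≤ ‖(x n : E) - T (x n)‖ := by
      rw [show (x n : E) - S (x n) = a • ((x n : E) - T (x n)) by rw [hSdef]; module,
        norm_smul, Real.norm_of_nonneg ha.1]
      exact mul_le_of_le_one_left (norm_nonneg _) ha.2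
    have h6 := norm_sub_le_norm_sub_add_norm_sub (x (n + 1) : E) (x n) (S (x (n + 1)))
    have h7 := norm_sub_le_norm_sub_add_norm_sub (x n : E) (S (x n)) (S (x (n + 1)))
    have h8 := hS (x n) (x (n + 1))
    rw [norm_sub_rev (x n : E)] at h8
    linarith
  have hlim : Tendsto (fun n => ‖(x n : E) - z‖ ^ 2) atTop (𝓝 0) := by
    refine tendsto_zero_of_eventually_succ_le (fun n => sq_nonneg _) (fun n => (hβ n).2) hβ_sum
      fun ε hε => ?_
    obtain ⟨η, hη, hvarη⟩ := hvar R (ε / 2) (half_pos hε)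
    have hP : 0 < R * ‖(u : E) - z‖ + 1 := by positivity
    filter_upwards [eventually_ge_atTop N, hlt (η / (4 * (D + 1))) (by positivity),
      hlt (c * (η / 6) ^ 2 / (2 * (R * ‖(u : E) - z‖ + 1))) (by positivity)] with n hn hβ1 hβ2
    obtain ⟨j, hj⟩ := normalizedDuality_nonempty ((x (n + 1) : E) - z)
    have h1 := hsq n hn j hj
    have hβ0 := (hβ n).1
    -- Below `η / 6`, `hdisp` gives displacement at most `3 * (η / 6) + η / 2 = η` at `x (n + 1)`.
    -- Above it, the term `c (η / 6) ^ 2` dominates `2 β n j (u - z)` because `β n` is small. No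
    -- passage to subsequences is needed.
    rcases le_total ‖(x n : E) - T (x n)‖ (η / 6) with hr | hr
    · have h2 : β n * (4 * (D + 1)) ≤ η := (le_div_iff₀ (by positivity)).1 hβ1
      have h3 := hvarη (x (n + 1)) (hbdd _ (by linarith)) (by
        have := hdisp n hn
        nlinarith) j hj
      have h4 := mul_le_mul_of_nonneg_left h3 hβ0
      have h5 : 0 ≤ c * ‖(x n : E) - T (x n)‖ ^ 2 := by positivity
      linarith
    · have h2 : β n * (2 * (R * ‖(u : E) - z‖ + 1)) ≤ c * (η / 6) ^ 2 :=
        (le_div_iff₀ (by positivity)).1 hβ2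
      have h3 : j ((u : E) - z) ≤ R * ‖(u : E) - z‖ :=
        (normalizedDuality.apply_le hj _).trans
          (mul_le_mul_of_nonneg_right (hbdd _ (by linarith)) (norm_nonneg _))
      have h4 := mul_le_mul_of_nonneg_left h3 hβ0
      have h5 : c * (η / 6) ^ 2 ≤ c * ‖(x n : E) - T (x n)‖ ^ 2 := by gcongr
      have h6 := mul_nonneg hβ0 hε.le
      linarith
  rw [tendsto_subtype_rng, tendsto_iff_norm_sub_tendsto_zero]
  have := hlim.sqrt
  simpa [Real.sqrt_sq] using this

/-- The anchored equation for `T` at `t` is the anchored equation for `a T + (1 - a) I` at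
`a t / (1 - t + a t)`. -/
theorem isAnchoredPoint_iff_of_smul_add {a t : ℝ} (ha : 0 < a) (ht : t ∈ Ioo (0 : ℝ) 1)
    (hSdef : ∀ x, (S x : E) = a • (T x : E) + (1 - a) • (x : E)) (p : C) :
    IsAnchoredPoint T u t p ↔ IsAnchoredPoint S u (a * t / (1 - t + a * t)) p := by
  have hd : 0 < 1 - t + a * t := by
    have := mul_pos ha ht.1
    linarith [ht.2]
  -- The residuals of the two equations are proportional, with a nonzero factor.
  have key : (p : E) - ((a * t / (1 - t + a * t)) • (u : E) +
      (1 - a * t / (1 - t + a * t)) • (S p : E)) =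
      (a / (1 - t + a * t)) • ((p : E) - (t • (u : E) + (1 - t) • (T p : E))) := by
    rw [hSdef]
    match_scalars <;> field_simp <;> ring
  unfold IsAnchoredPoint
  rw [← sub_eq_zero, ← sub_eq_zero (b := (a * t / (1 - t + a * t)) • (u : E) + _), key,
    smul_eq_zero_iff_right (div_pos ha hd).ne']

end StrictPseudocontraction

/-! ### The main theorem. -/

theorem theorem3p1 {E : Type*} [NormedAddCommGroup E] [NormedSpace ℝ E] [CompleteSpace E]
    (hE : IsTwoUniformlySmooth E)
    (C : Set E) (hC_closed : IsClosed C) (hC_convex : Convex ℝ C)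
    (lam : ℝ) (T : C → C) (hT : IsStrictPseudocontraction lam T)
    (hfix : ∃ p : C, T p = p)
    (α β γ : ℕ → ℝ)
    (hα : ∀ n, α n ∈ Icc (0 : ℝ) (min 1 (lam / bestSmoothnessConstant E ^ 2)))
    (hα_liminf :
      0 < liminf (fun n => α n * (lam - bestSmoothnessConstant E ^ 2 * α n)) atTop)
    (hβ : ∀ n, β n ∈ Icc (0 : ℝ) 1)
    (hβ_lim : Tendsto β atTop (𝓝 0))
    (hβ_sum : Tendsto (fun n => ∑ i ∈ Finset.range n, β i) atTop atTop)
    (hγ : ∀ n, γ n ∈ Icc (0 : ℝ) 1)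
    (hγ_limsup : limsup γ atTop < 1)
    (u : C) (x : ℕ → C)
    (hx : ∀ n, (x (n + 1) : E) = β n • (u : E) + γ n • (x n : E) +
      (1 - β n - γ n) • (α n • (T (x n) : E) + (1 - α n) • (x n : E))) :
    ∃ z : C, T z = z ∧ Tendsto x atTop (𝓝 z) ∧
      ∃ y : ℝ → C,
        (∀ t ∈ Ioo (0 : ℝ) 1, ∀ p : C,
          (p : E) = t • (u : E) + (1 - t) • (T p : E) ↔ p = y t) ∧
        Tendsto y (𝓝[>] 0) (𝓝 z) := by
  have hK := hE.hasSmoothnessConstant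
  set K := bestSmoothnessConstant E
  have hα1 : ∀ n, α n ∈ Icc (0 : ℝ) 1 := fun n => ⟨(hα n).1, (hα n).2.trans (min_le_left _ _)⟩
  have hαK : ∀ n, K ^ 2 * α n ≤ lam := by
    intro n
    -- When `K = 0` the quotient `lam / K ^ 2` is `0` by convention and carries no information, but
    -- the claim is then just `0 ≤ lam`.
    rcases eq_or_ne K 0 with h0 | h0
    · simp [h0, hT.1.1.le]
    · have := (le_div_iff₀ (by positivity)).1 ((hα n).2.trans (min_le_right _ _))
      linarith
  obtain ⟨κ, hκ, hκlim⟩ := exists_between hα_liminf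
  have hακ : ∀ᶠ n in atTop, κ < α n * (lam - K ^ 2 * α n) :=
    eventually_lt_of_lt_liminf hκlim (isBoundedUnder_of ⟨0, fun n =>
      mul_nonneg (hα1 n).1 (sub_nonneg.2 (hαK n))⟩)
  obtain ⟨g, hglim, hg⟩ := exists_between hγ_limsup
  have hγg : ∀ᶠ n in atTop, γ n < g :=
    eventually_lt_of_limsup_lt hglim (isBoundedUnder_of ⟨1, fun n => (hγ n).2⟩)
  -- A single `α N` with `α N (lam - K ^ 2 α N) > 0` serves as the averaging parameter: it gives
  -- both `a > 0` and `K ^ 2 * a < lam`.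
  obtain ⟨N, hN⟩ := hακ.exists
  set a := α N
  have ha : 0 < a := (hα1 N).1.lt_of_ne fun h => by
    rw [show a = 0 from h.symm, zero_mul] at hN
    linarith
  have haK : 0 < lam - K ^ 2 * a := pos_of_mul_pos_right (hκ.trans hN) ha.le
  let S : C → C := fun p => ⟨a • (T p : E) + (1 - a) • (p : E),
    hC_convex (T p).2 p.2 ha.le (sub_nonneg.2 (hα1 N).2) (by ring)⟩
  have hSdef : ∀ p, (S p : E) = a • (T p : E) + (1 - a) • (p : E) := fun p => rfl
  have hSav := hT.isAveraged hK ha hSdef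
  have hδ : 0 < 2 * (lam - K ^ 2 * a) / a := by positivity
  have hS := hSav.norm_sub_le hδ.le
  have hfixS : ∀ p, S p = p ↔ T p = p := by
    intro p
    rw [Subtype.ext_iff, Subtype.ext_iff, ← sub_eq_zero, ← sub_eq_zero (a := (T p : E)),
      show (S p : E) - p = a • ((T p : E) - p) by rw [hSdef]; module,
      smul_eq_zero_iff_right ha.ne']
  have : Nonempty C := ⟨u⟩
  choose! y hy using fun t (ht : t ∈ Ioo (0 : ℝ) 1) =>
    existsUnique_isAnchoredPoint hC_closed hC_convex hS u ht
  have hya : ∀ t ∈ Ioo (0 : ℝ) 1, IsAnchoredPoint S u t (y t) := fun t ht => (hy t ht _).2 rfl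
  obtain ⟨z, hz, hyz⟩ := exists_tendsto_anchored hE.surjective_inclusionInDoubleDual hK hC_closed
    hC_convex hδ hSav (hfix.imp fun p hp => (hfixS p).2 hp) hya
  refine ⟨z, (hfixS z).1 hz, ?_, fun t => y (a * t / (1 - t + a * t)), fun t ht p => ?_, ?_⟩
  · exact hT.tendsto_anchored_iteration hK ((hfixS z).1 hz) (hα1 N) hSdef hS
      (fun R ε hε => exists_forall_apply_sub_le hK hS hya hz hyz R hε) hα1 hαK hκ
      (hακ.mono fun n hn => hn.le) hβ hβ_lim hβ_sum (fun n => (hγ n).1) hg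
      (hγg.mono fun n hn => hn.le) hx
  · refine (isAnchoredPoint_iff_of_smul_add ha ht hSdef p).trans (hy _ ?_ p)
    have h1 := mul_pos ha ht.1
    have h2 : 0 < 1 - t + a * t := by linarith [ht.2]
    exact ⟨div_pos h1 h2, (div_lt_one h2).2 (by linarith [ht.2])⟩
  · refine hyz.comp (tendsto_nhdsWithin_iff.2 ⟨?_, ?_⟩)
    · have : ContinuousAt (fun t : ℝ => a * t / (1 - t + a * t)) 0 :=
        ContinuousAt.div (by fun_prop) (by fun_prop) (by norm_num)
      have h := this.tendsto
      simp only [mul_zero, zero_div] at h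
      exact h.mono_left nhdsWithin_le_nhds
    · filter_upwards [Ioo_mem_nhdsGT one_pos] with t ht
      have h1 := mul_pos ha ht.1
      exact div_pos h1 (by linarith [ht.2])
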